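/- Let $N=\{1,\dots,n\}$ be a set of items with fixed prices $r_1,\dots,r_n\ge 0$. A buyer's type is a list $\ell$, i.e. a strictly ordered subset of $N$ (most preferred item first; items not on $\ell$ are never bought), drawn from a distribution $p$ on a finite set $\mathcal L$ of lists. Write $\ell_{1:k}$ for the first $k$ items of $\ell$. For an assortment $S\subseteq N$ let $$\mathrm{Rev}[S]=\sum_{j\in S} r_j\Pr[j\text{ is the first item of }S\text{ on }\ell].$$ An IC mechanism $x$ consists of numbers $x_j(\ell)\ge 0$ ($\ell\in\mathcal L$, $j\in\ell$) with $\sum_{j\in\ell}x_j(\ell)\le 1$ for all $\ell\in\mathcal L$ and $$\sum_{j\in\ell_{1:k}}x_j(\ell)\ \ge\ \sum_{j\in\ell_{1:k}\cap\ell'}x_j(\ell')\qquad\text{for all }\ell,\ell'\in\mathcal L,\ k\le|\ell|,$$ and its revenue is $\mathrm{Rev}[x]=\sum_{\ell\in\mathcal L}p(\ell)\sum_{j\in\ell}r_jx_j(\ell)$. Markov Chain choice model: a Markov chain on $N\cup\{0\}$ starts in state $j\in N\cup\{0\}$ with probability $\lambda_j$ and moves from $j\in N$ to $j'\in N\cup\{0\}$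 with probability $\sigma_{jj'}$, where $0$ is terminal and is reached with probability 1; the list consists of the items visited before reaching $0$, in order of first visit, and $p$ is its distribution. Multi-Nomial Logit (MNL) model: given weights $w_0,\dots,w_n>0$, balls $0,\dots,n$ are drawn without replacement from an urn, each time with probability proportional to weight among the remaining balls; the list consists of the labels drawn before ball $0$, in order, and $p$ is its distribution. Theorem. If $p$ arises from a Markov Chain choice model, then for any prices $r_1,\dots,r_n\ge0$ assortments are optimal among IC mechanisms: $$\max_{S\subseteq N}\mathrm{Rev}[S]=\max_{x\text{ IC}}\mathrm{Rev}[x],$$ both maxima being attained; more precisely, for some assortment $S$ maximizing $\mathrm{Rev}[S]$, the mechanism with $x_j(\ell)=1$ if $j$ is the first item of $S$ on $\ell$ and $x_j(\ell)=0$ otherwise is IC, has revenue $\mathrm{Rev}[S]$, and is optimal among all IC mechanisms. The same holds if $p$ is the list distribution of an MNL model. -/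

import Mathlib

open MeasureTheory

noncomputable section

namespace FixedPrice

/-- A distribution over buyer types.  A type is a strictly ordered subset of the items `Fin n`
(a duplicate-free list, most preferred item first).  The distribution has a finite support of
lists and a probability for each list of the support. -/
structure ListDistribution (n : ℕ) where
  support : Finset (List (Fin n))
  nodup : ∀ l ∈ support, l.Nodup
  prob : List (Fin n) → ℝ
  prob_nonneg : ∀ l ∈ support, 0 ≤ prob l
  sum_prob : ∑ l ∈ support, prob l = 1

/-- Offered the assortment `S`, a buyer with list `l` chooses `j`: the first item of `l` that
lies in `S` is `j`. -/
def Chooses {n : ℕ} (l : List (Fin n)) (S : Finset (Fin n)) (j : Fin n) : Prop :=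
  l.find? (fun i => decide (i ∈ S)) = some j

instance {n : ℕ} (l : List (Fin n)) (S : Finset (Fin n)) (j : Fin n) :
    Decidable (Chooses l S j) :=
  inferInstanceAs (Decidable (l.find? (fun i => decide (i ∈ S)) = some j))

/-- A mechanism assigns to a reported list `l` and an item `j` a number `x l j`, the probability
of assigning `j` when `l` is reported (only the values at items `j` of `l` are ever used). -/
abbrev Mechanism (n : ℕ) : Type := List (Fin n) → Fin n → ℝ

/-- The deterministic mechanism that corresponds to offering the assortment `S`. -/
def assortmentMechanism {n : ℕ} (S : Finset (Fin n)) : Mechanism n :=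
  fun l j => if Chooses l S j then 1 else 0

namespace ListDistribution

variable {n : ℕ} (D : ListDistribution n)

/-- The probability that item `j` is chosen from the assortment `S`. -/
def choiceProb (S : Finset (Fin n)) (j : Fin n) : ℝ :=
  ∑ l ∈ D.support with Chooses l S j, D.prob l

/-- The expected revenue of the assortment `S` at prices `r`. -/
def assortmentRevenue (r : Fin n → ℝ) (S : Finset (Fin n)) : ℝ :=
  ∑ j ∈ S, r j * D.choiceProb S j

/-- Feasibility of a mechanism: for every `k`, truthful reporting maximizes the probability of
receiving one of the `k` most preferred items; at most one item is assigned; probabilities are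
nonnegative. -/
structure IsIC (x : Mechanism n) : Prop where
  incentive : ∀ l ∈ D.support, ∀ k ≤ l.length, ∀ l' ∈ D.support,
    ∑ j ∈ (l.take k).toFinset ∩ l'.toFinset, x l' j ≤ ∑ j ∈ (l.take k).toFinset, x l j
  sum_le_one : ∀ l ∈ D.support, ∑ j ∈ l.toFinset, x l j ≤ 1
  nonneg : ∀ l ∈ D.support, ∀ j ∈ l, 0 ≤ x l j

/-- The expected revenue of the mechanism `x` at prices `r`. -/
def mechanismRevenue (r : Fin n → ℝ) (x : Mechanism n) : ℝ :=
  ∑ l ∈ D.support, D.prob l * ∑ j ∈ l.toFinset, r j * x l j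

/-- Assortments are optimal within the class of IC mechanisms: some assortment `S` is optimal
among assortments, its mechanism is IC and earns the revenue of `S`, and this revenue is the
maximum over all IC mechanisms. -/
def AssortmentsOptimal (r : Fin n → ℝ) : Prop :=
  ∃ S : Finset (Fin n),
    IsGreatest (Set.range (D.assortmentRevenue r)) (D.assortmentRevenue r S) ∧
    D.IsIC (assortmentMechanism S) ∧
    D.mechanismRevenue r (assortmentMechanism S) = D.assortmentRevenue r S ∧
    IsGreatest {v : ℝ | ∃ x : Mechanism n, D.IsIC x ∧ D.mechanismRevenue r x = v}
      (D.assortmentRevenue r S)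

end ListDistribution

/-- The parameters of a Markov chain on the items and the terminal state `0`, written `none`:
initial probabilities and the transition probabilities out of each item. -/
structure ChainParams (n : ℕ) where
  init : Option (Fin n) → ℝ
  init_nonneg : ∀ s, 0 ≤ init s
  sum_init : ∑ s, init s = 1
  trans : Fin n → Option (Fin n) → ℝ
  trans_nonneg : ∀ j s, 0 ≤ trans j s
  sum_trans : ∀ j, ∑ s, trans j s = 1

/-- One-step probabilities; the process stays at the terminal state once it is there. -/
def ChainParams.step {n : ℕ} (C : ChainParams n) : Option (Fin n) → Option (Fin n) → ℝ
  | some j, s => C.trans j s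
  | none, s => if s = none then 1 else 0

/-- `X` is a Markov chain with the given initial and transition probabilities that reaches the
terminal state with probability one. -/
structure ChainParams.IsTerminatingChain {n : ℕ} (C : ChainParams n) {Ω : Type*}
    [MeasurableSpace Ω] (μ : Measure Ω) (X : ℕ → Ω → Option (Fin n)) : Prop where
  measurable : ∀ t s, MeasurableSet {ω | X t ω = s}
  law : ∀ (t : ℕ) (x : ℕ → Option (Fin n)),
    μ.real {ω | ∀ s ≤ t, X s ω = x s} =
      C.init (x 0) * ∏ s ∈ Finset.range t, C.step (x s) (x (s + 1))
  terminates : ∀ᵐ ω ∂μ, ∃ t, X t ω = none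

/-- The items visited at the times `0, …, t - 1`, each listed once, in order of first visit. -/
def firstVisits {n : ℕ} (x : ℕ → Option (Fin n)) : ℕ → List (Fin n)
  | 0 => []
  | t + 1 =>
    match x t with
    | none => firstVisits x t
    | some j => if j ∈ firstVisits x t then firstVisits x t else firstVisits x t ++ [j]

/-- The trajectory `x` generates the list `l`: `x` reaches the terminal state for the first time
at some time `T`, and `l` lists the items visited before `T` in order of first visit. -/
def Generates {n : ℕ} (x : ℕ → Option (Fin n)) (l : List (Fin n)) : Prop :=
  ∃ T : ℕ, x T = none ∧ (∀ t < T, x t ≠ none) ∧ firstVisits x T = l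

/-- The list distribution `D` is the law of the list generated by the random trajectory `X`. -/
def ListDistribution.IsLawOfGeneratedList {n : ℕ} (D : ListDistribution n) {Ω : Type*}
    [MeasurableSpace Ω] (μ : Measure Ω) (X : ℕ → Ω → Option (Fin n)) : Prop :=
  ∀ l ∈ D.support, D.prob l = μ.real {ω | Generates (fun t => X t ω) l}

/-- The probability of drawing exactly the labels of `l` in order, and then the `0`-ball
(label `none`), when sampling without replacement, proportionally to the weights `w`, from an urn
that holds the `0`-ball and the balls in `R`. -/
def urnProb {n : ℕ} (w : Option (Fin n) → ℝ) : Finset (Fin n) → List (Fin n) → ℝ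
  | R, [] => w none / (w none + ∑ i ∈ R, w (some i))
  | R, j :: l =>
    if j ∈ R then w (some j) / (w none + ∑ i ∈ R, w (some i)) * urnProb w (R.erase j) l else 0

/-- The list distribution of the Multi-Nomial Logit model with weights `w`. -/
def ListDistribution.IsMNL {n : ℕ} (D : ListDistribution n) (w : Option (Fin n) → ℝ) : Prop :=
  (∀ s, 0 < w s) ∧ ∀ l ∈ D.support, D.prob l = urnProb w Finset.univ l

end FixedPrice

end

/-! Reading a list from the top, an IC mechanism is a randomized stopping rule. Comparing two types
whose lists share a prefix `u`, at `k = u.length` and in both directions, shows that they get the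
same total probability on `u` (`IsIC.sum_prefix_eq`), so the probability left over depends only on
what has been seen. The value of this stopping problem is controlled by a function `c` of the last
item alone (`IsStoppingCertificate`). Superharmonicity and backward induction on prefixes bound
every IC revenue by `c none` (`IsStoppingCertificate.mechanismRevenue_le`). Harmonicity along
prefixes with `r j < c (some j)` shows that the threshold assortment of the items with `c (some j) ≤
r j` earns exactly `c none` (`IsStoppingCertificate.continuation_eq`).

For a Markov chain with transition operator `P`, take `g = max r (P g)`, let `c` be `P g` at items
and the initial average of `g` at `none`. When the chain first visits `i`, with visited items `u`,
the next new item is the state in which it leaves `u`. Since `P g ≤ g`, the mean of `g` at that exit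
is at most `P g` at `i`, with equality if `g = P g` on `u`. `sum_reaches_balance` is this statement
up to a finite time, and termination removes the remainder in the limit.

For MNL, drawing with replacement is a chain all of whose states have the same transition law, so
`c` is a constant `V`. Its inequalities are checked directly on the urn probabilities, without
trajectories. -/

noncomputable section

namespace FixedPrice

/-! ### Prefix probabilities and stopping certificates. -/

namespace ListDistribution

variable {n : ℕ} (D : ListDistribution n)

/-- The probability that the list of the buyer starts with `u`. -/
def prefixProb (u : List (Fin n)) : ℝ :=
  ∑ l ∈ D.support with u <+: l, D.prob l

/-- A list extending `u` either equals `u` or continues with exactly one next item, which is new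
because lists have no duplicates. -/
theorem sum_prefix_split (f : List (Fin n) → ℝ) (u : List (Fin n)) :
    ∑ l ∈ D.support with u <+: l, f l =
      (if u ∈ D.support then f u else 0) +
        ∑ j with j ∉ u, ∑ l ∈ D.support with u ++ [j] <+: l, f l := by
  have h1 : (if u ∈ D.support then f u else 0) = ∑ l ∈ D.support, if l = u then f l else 0 := by
    rw [Finset.sum_ite_eq']
  simp_rw [h1, Finset.sum_filter]
  have h2 : ∀ j : Fin n, (if j ∉ u then ∑ l ∈ D.support, (if u ++ [j] <+: l then f l else 0) else 0)
      = ∑ l ∈ D.support, if j ∉ u ∧ u ++ [j] <+: l then f l else 0 := by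
    intro j
    by_cases hj : j ∈ u <;> simp [hj]
  simp_rw [h2]
  rw [Finset.sum_comm, ← Finset.sum_add_distrib]
  refine Finset.sum_congr rfl fun l hl => ?_
  have hnd := D.nodup l hl
  by_cases hul : u <+: l
  · obtain ⟨t, rfl⟩ := hul
    cases t with
    | nil =>
      have : ∀ j, ¬ (j ∉ u ∧ u ++ [j] <+: u ++ []) := by
        rintro j ⟨-, h⟩
        simpa using h.length_le
      simp only [this, if_false, Finset.sum_const_zero]
      simp
    | cons a t =>
      have ha : a ∉ u := by
        intro h
        exact (List.nodup_append.1 hnd).2.2 a h a (by simp) rfl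
      have : ∀ j, (j ∉ u ∧ u ++ [j] <+: u ++ a :: t) ↔ j = a := by
        intro j
        rw [List.prefix_append_right_inj, List.cons_prefix_cons]
        constructor
        · rintro ⟨_, h, _⟩; exact h
        · rintro rfl; exact ⟨ha, rfl, List.nil_prefix⟩
      simp_rw [this]
      simp
  · have h3 : l ≠ u := by rintro rfl; exact hul (List.prefix_refl _)
    have h4 : ∀ j, ¬ (j ∉ u ∧ u ++ [j] <+: l) :=
      fun j h => hul ((List.prefix_append u [j]).trans h.2)
    simp [hul, h3, h4]

/-- Base case of the backward inductions on `n + 1 - u.length`: a duplicate-free list has at most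
`n` items. -/
theorem filter_prefix_eq_empty {u : List (Fin n)} (hu : n < u.length) :
    D.support.filter (u <+: ·) = ∅ := by
  rw [Finset.filter_eq_empty_iff]
  intro l hl h
  have := (D.nodup l hl).length_le_card
  have := h.length_le
  simp at *
  omega

theorem prefixProb_nonneg (u : List (Fin n)) : 0 ≤ D.prefixProb u :=
  Finset.sum_nonneg fun l hl => D.prob_nonneg l (Finset.mem_filter.1 hl).1

theorem prefixProb_nil : D.prefixProb [] = 1 := by
  simp [prefixProb, D.sum_prob]

theorem prefixProb_split (u : List (Fin n)) :
    D.prefixProb u = (if u ∈ D.support then D.prob u else 0) +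
      ∑ j with j ∉ u, D.prefixProb (u ++ [j]) :=
  D.sum_prefix_split D.prob u

theorem nodup_append_singleton {u : List (Fin n)} {j : Fin n} (hu : u.Nodup) (hj : j ∉ u) :
    (u ++ [j]).Nodup := by
  simpa [List.nodup_append, hu] using fun a ha (h : a = j) => hj (h ▸ ha)

/-- A function `c` of the last item seen that bounds the value of continuing down the list, and
that is the exact value of continuing as long as every item seen is worth less than `c`. -/
structure IsStoppingCertificate (r : Fin n → ℝ) (c : Option (Fin n) → ℝ) : Prop where
  nonneg : ∀ s, 0 ≤ c s
  superharmonic : ∀ u : List (Fin n), u.Nodup →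
    ∑ j with j ∉ u, D.prefixProb (u ++ [j]) * max (r j) (c (some j)) ≤
      D.prefixProb u * c u.getLast?
  harmonic : ∀ u : List (Fin n), u.Nodup → (∀ j ∈ u, r j < c (some j)) →
    ∑ j with j ∉ u, D.prefixProb (u ++ [j]) * max (r j) (c (some j)) =
      D.prefixProb u * c u.getLast?

/-! ### The certificate bounds every IC mechanism. -/

variable {D}

theorem IsIC.sum_prefix_eq {x : Mechanism n} (hx : D.IsIC x) {u l l' : List (Fin n)}
    (hl : l ∈ D.support) (hl' : l' ∈ D.support) (hu : u <+: l) (hu' : u <+: l') :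
    ∑ j ∈ u.toFinset, x l j = ∑ j ∈ u.toFinset, x l' j := by
  have key : ∀ {l l' : List (Fin n)}, l ∈ D.support → l' ∈ D.support → u <+: l → u <+: l' →
      ∑ j ∈ u.toFinset, x l' j ≤ ∑ j ∈ u.toFinset, x l j := by
    intro l l' hl hl' hu hu'
    have h := hx.incentive l hl u.length hu.length_le l' hl'
    rw [← List.prefix_iff_eq_take.1 hu] at h
    rwa [Finset.inter_eq_left.2] at h
    intro j hj
    exact List.mem_toFinset.2 (hu'.subset (List.mem_toFinset.1 hj))
  exact le_antisymm (key hl' hl hu' hu) (key hl hl' hu hu')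

theorem IsIC.sum_prefix_le_one {x : Mechanism n} (hx : D.IsIC x) {u l : List (Fin n)}
    (hl : l ∈ D.support) (hu : u <+: l) : ∑ j ∈ u.toFinset, x l j ≤ 1 := by
  refine le_trans (Finset.sum_le_sum_of_subset_of_nonneg ?_ ?_) (hx.sum_le_one l hl)
  · intro j hj
    exact List.mem_toFinset.2 (hu.subset (List.mem_toFinset.1 hj))
  · intro j hj _
    exact hx.nonneg l hl j (List.mem_toFinset.1 hj)

/-- Backward induction on the prefix: revenue still to come is at most the unassigned probability
times the certified value of continuing. -/
theorem IsStoppingCertificate.continuation_le {r : Fin n → ℝ} {c : Option (Fin n) → ℝ}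
    (hc : D.IsStoppingCertificate r c) {x : Mechanism n} (hx : D.IsIC x) :
    ∀ (m : ℕ) (u : List (Fin n)), u.Nodup → n + 1 - u.length ≤ m →
      ∑ l ∈ D.support with u <+: l, D.prob l * ∑ j ∈ l.toFinset \ u.toFinset, r j * x l j ≤
        ∑ l ∈ D.support with u <+: l,
          D.prob l * ((1 - ∑ j ∈ u.toFinset, x l j) * c u.getLast?) := by
  intro m
  induction m with
  | zero =>
    intro u _ hm
    rw [D.filter_prefix_eq_empty (by omega)]
    simp
  | succ m ih =>
    intro u hu hm
    rcases (D.support.filter (u <+: ·)).eq_empty_or_nonempty with he | ⟨l₀, hl₀⟩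
    · rw [he]; simp
    rw [Finset.mem_filter] at hl₀
    -- By incentive compatibility the unassigned probability `q` is common to all lists through `u`,
    -- so it factors out of the sum and superharmonicity applies.
    set q : ℝ := 1 - ∑ j ∈ u.toFinset, x l₀ j with hq
    have hq0 : 0 ≤ q := sub_nonneg.2 (hx.sum_prefix_le_one hl₀.1 hl₀.2)
    have hql : ∀ l ∈ D.support, u <+: l → 1 - ∑ j ∈ u.toFinset, x l j = q := by
      intro l hl hul
      rw [hq, hx.sum_prefix_eq hl hl₀.1 hul hl₀.2]
    have hR : ∑ l ∈ D.support with u <+: l,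
          D.prob l * ((1 - ∑ j ∈ u.toFinset, x l j) * c u.getLast?) =
        q * (D.prefixProb u * c u.getLast?) := by
      rw [prefixProb, Finset.sum_mul, Finset.mul_sum]
      refine Finset.sum_congr rfl fun l hl => ?_
      rw [Finset.mem_filter] at hl
      rw [hql l hl.1 hl.2]; ring
    rw [hR]
    refine le_trans ?_ (mul_le_mul_of_nonneg_left (hc.superharmonic u hu) hq0)
    rw [D.sum_prefix_split]
    have h0 : (if u ∈ D.support then
        D.prob u * ∑ j ∈ u.toFinset \ u.toFinset, r j * x u j else 0) = 0 := by simp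
    rw [h0, zero_add, Finset.mul_sum]
    refine Finset.sum_le_sum fun j hj => ?_
    have hj : j ∉ u := (Finset.mem_filter.1 hj).2
    have hsplit : ∀ l, u ++ [j] <+: l → l.toFinset \ u.toFinset =
        insert j (l.toFinset \ (u ++ [j]).toFinset) := by
      intro l hl
      have hjl : j ∈ l := hl.subset (by simp)
      ext i
      by_cases hij : i = j
      · subst hij; simp [hj, hjl]
      · simp [hij]
    have hnot : ∀ l : List (Fin n), j ∉ l.toFinset \ (u ++ [j]).toFinset := by simp
    have hL : ∑ l ∈ D.support with u ++ [j] <+: l,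
          D.prob l * ∑ i ∈ l.toFinset \ u.toFinset, r i * x l i =
        ∑ l ∈ D.support with u ++ [j] <+: l, D.prob l * (r j * x l j) +
        ∑ l ∈ D.support with u ++ [j] <+: l,
          D.prob l * ∑ i ∈ l.toFinset \ (u ++ [j]).toFinset, r i * x l i := by
      rw [← Finset.sum_add_distrib]
      refine Finset.sum_congr rfl fun l hl => ?_
      rw [hsplit l (Finset.mem_filter.1 hl).2, Finset.sum_insert (hnot l)]
      ring
    rw [hL]
    refine le_trans (add_le_add_right (ih (u ++ [j]) (nodup_append_singleton hu hj)
      (by simp; omega)) _) ?_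
    rw [← Finset.sum_add_distrib, prefixProb, Finset.sum_mul, Finset.mul_sum]
    refine Finset.sum_le_sum fun l hl => ?_
    rw [Finset.mem_filter] at hl
    have hp := D.prob_nonneg l hl.1
    have hul : u <+: l := (List.prefix_append u [j]).trans hl.2
    have hxj : 0 ≤ x l j := hx.nonneg l hl.1 j (hl.2.subset (by simp))
    have hs : ∑ i ∈ (u ++ [j]).toFinset, x l i = x l j + ∑ i ∈ u.toFinset, x l i := by
      rw [← Finset.sum_insert (by simpa using hj)]
      congr 1
      ext i; simp
    have hle := hx.sum_prefix_le_one hl.1 hl.2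
    have hqe := hql l hl.1 hul
    have hrest : 0 ≤ q - x l j := by rw [← hqe]; linarith
    have e : 1 - ∑ i ∈ (u ++ [j]).toFinset, x l i = q - x l j := by rw [hs, ← hqe]; ring
    rw [e, List.getLast?_append_of_ne_nil _ (by simp), List.getLast?_singleton, ← mul_add]
    -- Of `q`, the part `x l j` stops at `j` for `r j` and the rest continues for `c (some j)`; both
    -- rates are at most their maximum.
    have h1 : r j * x l j ≤ max (r j) (c (some j)) * x l j :=
      mul_le_mul_of_nonneg_right (le_max_left _ _) hxj
    have h2 : (q - x l j) * c (some j) ≤ (q - x l j) * max (r j) (c (some j)) :=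
      mul_le_mul_of_nonneg_left (le_max_right _ _) hrest
    calc D.prob l * (r j * x l j + (q - x l j) * c (some j))
        ≤ D.prob l * (q * max (r j) (c (some j))) :=
          mul_le_mul_of_nonneg_left (by linarith) hp
      _ = _ := by ring

theorem IsStoppingCertificate.mechanismRevenue_le {r : Fin n → ℝ} {c : Option (Fin n) → ℝ}
    (hc : D.IsStoppingCertificate r c) {x : Mechanism n} (hx : D.IsIC x) :
    D.mechanismRevenue r x ≤ c none := by
  have h := hc.continuation_le hx (n + 1) [] (by simp) (by simp)
  simpa [mechanismRevenue, ← Finset.sum_mul, D.sum_prob] using h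

/-! ### Assortment mechanisms; the threshold assortment attains the bound. -/

/-- The price of the item that the buyer with list `l` chooses from `S`, and `0` if none. -/
def chosenPrice (r : Fin n → ℝ) (S : Finset (Fin n)) (l : List (Fin n)) : ℝ :=
  (l.find? (fun i => decide (i ∈ S))).elim 0 r

theorem sum_chooses (r : Fin n → ℝ) (S A : Finset (Fin n)) (l : List (Fin n))
    (hA : ∀ j ∈ l, j ∈ S → j ∈ A) :
    ∑ j ∈ A, r j * (if Chooses l S j then 1 else 0) = chosenPrice r S l := by
  unfold Chooses chosenPrice
  rcases Option.eq_none_or_eq_some (l.find? (fun i => decide (i ∈ S))) with h | ⟨i, h⟩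
  · simp [h]
  · have hi : i ∈ A := hA i (List.mem_of_find?_eq_some h) (by simpa using List.find?_some h)
    simp [h, hi]

theorem assortmentRevenue_eq (D : ListDistribution n) (r : Fin n → ℝ) (S : Finset (Fin n)) :
    D.assortmentRevenue r S = ∑ l ∈ D.support, D.prob l * chosenPrice r S l := by
  unfold assortmentRevenue choiceProb
  simp_rw [Finset.sum_filter, Finset.mul_sum]
  rw [Finset.sum_comm]
  refine Finset.sum_congr rfl fun l _ => ?_
  rw [← sum_chooses r S S l (fun _ _ h => h), Finset.mul_sum]
  refine Finset.sum_congr rfl fun j _ => ?_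
  split_ifs <;> ring

theorem mechanismRevenue_assortmentMechanism (D : ListDistribution n) (r : Fin n → ℝ)
    (S : Finset (Fin n)) :
    D.mechanismRevenue r (assortmentMechanism S) = D.assortmentRevenue r S := by
  rw [assortmentRevenue_eq]
  unfold mechanismRevenue assortmentMechanism
  refine Finset.sum_congr rfl fun l _ => ?_
  rw [sum_chooses r S _ l (fun j h _ => List.mem_toFinset.2 h)]

theorem sum_assortmentMechanism (S A : Finset (Fin n)) (l : List (Fin n)) :
    ∑ j ∈ A, assortmentMechanism S l j = if ∃ j ∈ A, Chooses l S j then 1 else 0 := by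
  unfold assortmentMechanism Chooses
  rcases Option.eq_none_or_eq_some (l.find? (fun i => decide (i ∈ S))) with h | ⟨i, h⟩
  · simp [h]
  · simp [h]

/-- If a misreport yields an item among the first `k` of `l`, that item lies in `S`, so the first
item of `S` on `l` is also among the first `k`. -/
theorem isIC_assortmentMechanism (D : ListDistribution n) (S : Finset (Fin n)) :
    D.IsIC (assortmentMechanism S) where
  incentive l _ k _ l' _ := by
    rw [sum_assortmentMechanism, sum_assortmentMechanism]
    by_cases h : ∃ j ∈ (l.take k).toFinset ∩ l'.toFinset, Chooses l' S j
    · obtain ⟨j, hj, hc⟩ := h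
      have hjS : j ∈ S := by simpa using List.find?_some hc
      have hjl : j ∈ l.take k := by simpa using (Finset.mem_inter.1 hj).1
      have hex : ∃ i ∈ (l.take k).toFinset, Chooses l S i := by
        obtain ⟨i, hi⟩ := Option.isSome_iff_exists.1
          ((List.find?_isSome (p := fun i => decide (i ∈ S))).2 ⟨j, hjl, by simpa using hjS⟩)
        refine ⟨i, List.mem_toFinset.2 (List.mem_of_find?_eq_some hi), ?_⟩
        unfold Chooses
        rw [← List.take_append_drop k l, List.find?_append, hi]
        rfl
      rw [if_pos hex]
      split_ifs <;> norm_num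
    · rw [if_neg h]
      split_ifs <;> norm_num
  sum_le_one l _ := by
    rw [sum_assortmentMechanism]
    split_ifs <;> norm_num
  nonneg l _ j _ := by
    unfold assortmentMechanism
    split_ifs <;> norm_num

theorem IsStoppingCertificate.continuation_eq {r : Fin n → ℝ} {c : Option (Fin n) → ℝ}
    (hc : D.IsStoppingCertificate r c) :
    ∀ (m : ℕ) (u : List (Fin n)), u.Nodup → n + 1 - u.length ≤ m →
      (∀ j ∈ u, r j < c (some j)) →
      ∑ l ∈ D.support with u <+: l,
        D.prob l * chosenPrice r (Finset.univ.filter fun j => c (some j) ≤ r j) l =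
        D.prefixProb u * c u.getLast? := by
  intro m
  induction m with
  | zero =>
    intro u _ hm _
    rw [prefixProb, D.filter_prefix_eq_empty (by omega)]
    simp
  | succ m ih =>
    intro u hu hm hS
    have hfind : u.find? (fun i => decide (i ∈ Finset.univ.filter fun j => c (some j) ≤ r j)) =
        none := by
      rw [List.find?_eq_none]
      intro i hi
      simpa using hS i hi
    rw [D.sum_prefix_split, ← hc.harmonic u hu hS]
    have h0 : chosenPrice r (Finset.univ.filter fun j => c (some j) ≤ r j) u = 0 := by
      unfold chosenPrice
      rw [hfind]; rfl
    rw [h0, mul_zero, ite_self, zero_add]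
    refine Finset.sum_congr rfl fun j hj => ?_
    have hj : j ∉ u := (Finset.mem_filter.1 hj).2
    by_cases hjS : c (some j) ≤ r j
    -- Here `j` is the first acceptable item on every list through `u ++ [j]`, so the price is `r
    -- j`; in the other case nothing is chosen yet and the induction continues.
    · rw [max_eq_left hjS, prefixProb, Finset.sum_mul]
      refine Finset.sum_congr rfl fun l hl => ?_
      obtain ⟨t, rfl⟩ := (Finset.mem_filter.1 hl).2
      congr 1
      unfold chosenPrice
      rw [List.find?_append, List.find?_append, hfind]
      simp [hjS]
    · push Not at hjS
      rw [ih (u ++ [j]) (nodup_append_singleton hu hj) (by simp; omega), max_eq_right hjS.le]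
      · simp
      · intro i hi
        rw [List.mem_append, List.mem_singleton] at hi
        rcases hi with hi | rfl
        · exact hS i hi
        · exact hjS

theorem IsStoppingCertificate.assortmentsOptimal {r : Fin n → ℝ} {c : Option (Fin n) → ℝ}
    (hc : D.IsStoppingCertificate r c) : D.AssortmentsOptimal r := by
  have hS : D.assortmentRevenue r (Finset.univ.filter fun j => c (some j) ≤ r j) = c none := by
    have h := hc.continuation_eq (n + 1) [] (by simp) (by simp) (by simp)
    rw [D.prefixProb_nil] at h
    rw [assortmentRevenue_eq]
    simpa using h
  refine ⟨Finset.univ.filter fun j => c (some j) ≤ r j, ⟨⟨_, rfl⟩, ?_⟩,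
    D.isIC_assortmentMechanism _, D.mechanismRevenue_assortmentMechanism r _,
    ⟨_, D.isIC_assortmentMechanism _, D.mechanismRevenue_assortmentMechanism r _⟩, ?_⟩
  · rintro _ ⟨T, rfl⟩
    rw [hS, ← mechanismRevenue_assortmentMechanism]
    exact hc.mechanismRevenue_le (D.isIC_assortmentMechanism T)
  · rintro _ ⟨x, hx, rfl⟩
    rw [hS]
    exact hc.mechanismRevenue_le hx

end ListDistribution

/-! ### Value function of optimal stopping on the chain. -/

/-- The value function of the optimal stopping problem with rewards `r`. -/
theorem ChainParams.exists_value {n : ℕ} (C : ChainParams n) (r : Fin n → ℝ) (hr : ∀ j, 0 ≤ r j) :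
    ∃ g : Fin n → ℝ, (∀ j, 0 ≤ g j) ∧
      ∀ j, g j = max (r j) (∑ k, C.trans j (some k) * g k) := by
  set M : ℝ := ∑ j, r j with hM
  have hM0 : 0 ≤ M := Finset.sum_nonneg fun j _ => hr j
  have hrM : ∀ j, r j ≤ M := fun j =>
    Finset.single_le_sum (f := r) (fun i _ => hr i) (Finset.mem_univ j)
  have hsum : ∀ j, ∑ k, C.trans j (some k) ≤ 1 := by
    intro j
    have h := C.sum_trans j
    rw [Fintype.sum_option] at h
    linarith [C.trans_nonneg j none]
  -- Functions into `[0, M]` form a complete lattice, so Knaster–Tarski gives a fixed point of the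
  -- monotone operator; only the fixed-point equation is used.
  have : Fact ((0 : ℝ) ≤ M) := ⟨hM0⟩
  let T : (Fin n → Set.Icc (0 : ℝ) M) →o (Fin n → Set.Icc (0 : ℝ) M) :=
    { toFun := fun g j => ⟨max (r j) (∑ k, C.trans j (some k) * (g k : ℝ)),
        le_max_of_le_left (hr j), max_le (hrM j) (by
          calc ∑ k, C.trans j (some k) * (g k : ℝ) ≤ ∑ k, C.trans j (some k) * M :=
                Finset.sum_le_sum fun k _ =>
                  mul_le_mul_of_nonneg_left (g k).2.2 (C.trans_nonneg j _)
            _ = (∑ k, C.trans j (some k)) * M := by rw [Finset.sum_mul]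
            _ ≤ 1 * M := mul_le_mul_of_nonneg_right (hsum j) hM0
            _ = M := one_mul M)⟩
      monotone' := by
        intro g g' h j
        refine Subtype.mk_le_mk.2 (max_le_max le_rfl ?_)
        exact Finset.sum_le_sum fun k _ =>
          mul_le_mul_of_nonneg_left (h k) (C.trans_nonneg j _) }
  refine ⟨fun j => (T.lfp j : ℝ), fun j => (T.lfp j).2.1, fun j => ?_⟩
  have h := congrArg Subtype.val (congrFun T.map_lfp j)
  exact h.symm

/-! ### Sampling without replacement. -/

section Urn

variable {n : ℕ} (w : Option (Fin n) → ℝ)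

/-- The probability that the draws from the urn with the `0`-ball and the balls in `R` start
with the labels of the list. -/
def urnPrefixProb : Finset (Fin n) → List (Fin n) → ℝ
  | _, [] => 1
  | R, j :: l =>
    if j ∈ R then w (some j) / (w none + ∑ i ∈ R, w (some i)) * urnPrefixProb (R.erase j) l else 0

theorem sdiff_toFinset_cons (R : Finset (Fin n)) (j : Fin n) (u : List (Fin n)) :
    R \ (j :: u).toFinset = R.erase j \ u.toFinset := by
  ext i; simp; tauto

theorem urnProb_eq (R : Finset (Fin n)) (u : List (Fin n)) :
    urnProb w R u = urnPrefixProb w R u *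
      (w none / (w none + ∑ i ∈ R \ u.toFinset, w (some i))) := by
  induction u generalizing R with
  | nil => simp [urnProb, urnPrefixProb]
  | cons j u ih =>
    rw [urnProb, urnPrefixProb, ih, sdiff_toFinset_cons]
    split_ifs <;> ring

theorem urnPrefixProb_append (R : Finset (Fin n)) (u : List (Fin n)) {j : Fin n}
    (hR : j ∈ R) (hj : j ∉ u) :
    urnPrefixProb w R (u ++ [j]) = urnPrefixProb w R u *
      (w (some j) / (w none + ∑ i ∈ R \ u.toFinset, w (some i))) := by
  induction u generalizing R with
  | nil => simp [urnPrefixProb, hR]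
  | cons k u ih =>
    simp only [List.mem_cons, not_or] at hj
    rw [List.cons_append, urnPrefixProb, urnPrefixProb,
      ih (R.erase k) (Finset.mem_erase.2 ⟨hj.1, hR⟩) hj.2, sdiff_toFinset_cons]
    split_ifs <;> ring

theorem urnPrefixProb_nonneg (hw : ∀ s, 0 < w s) (R : Finset (Fin n)) (u : List (Fin n)) :
    0 ≤ urnPrefixProb w R u := by
  induction u generalizing R with
  | nil => simp [urnPrefixProb]
  | cons j u ih =>
    rw [urnPrefixProb]
    split_ifs
    · exact mul_nonneg (div_nonneg (hw _).le
        (add_nonneg (hw _).le (Finset.sum_nonneg fun _ _ => (hw _).le))) (ih _)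
    · exact le_rfl

theorem sum_notMem_eq (f : Fin n → ℝ) (u : List (Fin n)) :
    ∑ j with j ∉ u, f j = ∑ j ∈ Finset.univ \ u.toFinset, f j := by
  congr 1
  ext; simp

theorem urn_denominator_pos (hw : ∀ s, 0 < w s) (R : Finset (Fin n)) :
    0 < w none + ∑ i ∈ R, w (some i) :=
  add_pos_of_pos_of_nonneg (hw _) (Finset.sum_nonneg fun _ _ => (hw _).le)

theorem urnPrefixProb_split (hw : ∀ s, 0 < w s) (u : List (Fin n)) :
    urnPrefixProb w Finset.univ u = urnProb w Finset.univ u +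
      ∑ j with j ∉ u, urnPrefixProb w Finset.univ (u ++ [j]) := by
  have h : ∑ j with j ∉ u, urnPrefixProb w Finset.univ (u ++ [j]) =
      ∑ j with j ∉ u, urnPrefixProb w Finset.univ u *
      (w (some j) / (w none + ∑ i ∈ Finset.univ \ u.toFinset, w (some i))) :=
    Finset.sum_congr rfl fun j hj =>
      urnPrefixProb_append w _ u (Finset.mem_univ j) (Finset.mem_filter.1 hj).2
  rw [h, urnProb_eq, sum_notMem_eq, ← Finset.mul_sum, ← Finset.sum_div, ← mul_add, ← add_div,
    div_self (urn_denominator_pos w hw _).ne', mul_one]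

end Urn

/-! ### The certificate for MNL. -/

namespace ListDistribution

variable {n : ℕ} {D : ListDistribution n} {w : Option (Fin n) → ℝ}

/-- Only an inequality at this stage: `D.support` could a priori omit lists of positive urn
probability. -/
theorem IsMNL.ite_prob_le (h : D.IsMNL w) (u : List (Fin n)) :
    (if u ∈ D.support then D.prob u else 0) ≤ urnProb w Finset.univ u := by
  split_ifs with hu
  · exact (h.2 u hu).le
  · rw [urnProb_eq]
    exact mul_nonneg (urnPrefixProb_nonneg w h.1 _ _)
      (div_nonneg (h.1 _).le (urn_denominator_pos w h.1 _).le)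

theorem IsMNL.prefixProb_le (h : D.IsMNL w) :
    ∀ (m : ℕ) (u : List (Fin n)), n + 1 - u.length ≤ m →
      D.prefixProb u ≤ urnPrefixProb w Finset.univ u := by
  intro m
  induction m with
  | zero =>
    intro u hm
    rw [prefixProb, D.filter_prefix_eq_empty (by omega), Finset.sum_empty]
    exact urnPrefixProb_nonneg w h.1 _ _
  | succ m ih =>
    intro u hm
    rw [prefixProb_split, urnPrefixProb_split w h.1]
    exact add_le_add (h.ite_prob_le u)
      (Finset.sum_le_sum fun j _ => ih (u ++ [j]) (by simp; omega))

/-- Both sides are 1 at the empty prefix and split over the next item; termwise inequalities between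
equal totals are equalities, so equality passes to longer prefixes. -/
theorem IsMNL.prefixProb_eq (h : D.IsMNL w) (u : List (Fin n)) (hu : u.Nodup) :
    D.prefixProb u = urnPrefixProb w Finset.univ u := by
  induction u using List.reverseRecOn with
  | nil => rw [prefixProb_nil, urnPrefixProb]
  | append_singleton u j ih =>
    have hnd := List.nodup_append.1 hu
    have hj : j ∉ u := fun hj => hnd.2.2 j hj j (by simp) rfl
    have h1 := ih hnd.1
    rw [prefixProb_split, urnPrefixProb_split w h.1] at h1
    have hle : ∀ i ∈ Finset.univ.filter (· ∉ u),
        D.prefixProb (u ++ [i]) ≤ urnPrefixProb w Finset.univ (u ++ [i]) :=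
      fun i _ => h.prefixProb_le _ _ le_rfl
    have h2 := h.ite_prob_le u
    have h3 := Finset.sum_le_sum hle
    exact (Finset.sum_eq_sum_iff_of_le hle).1 (by linarith) j (by simpa using hj)

/-- The Markov chain whose list of first visits follows the Multi-Nomial Logit model: every
state is drawn with replacement, proportionally to the weights. -/
def mnlChain (w : Option (Fin n) → ℝ) (hw : ∀ s, 0 < w s) : ChainParams n where
  init s := w s / ∑ i, w i
  init_nonneg s := div_nonneg (hw s).le (Finset.sum_nonneg fun i _ => (hw i).le)
  sum_init := by
    rw [← Finset.sum_div]
    exact div_self (Finset.sum_pos (fun i _ => hw i) Finset.univ_nonempty).ne'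
  trans _ s := w s / ∑ i, w i
  trans_nonneg _ s := div_nonneg (hw s).le (Finset.sum_nonneg fun i _ => (hw i).le)
  sum_trans _ := by
    rw [← Finset.sum_div]
    exact div_self (Finset.sum_pos (fun i _ => hw i) Finset.univ_nonempty).ne'

theorem IsMNL.exists_certificate (h : D.IsMNL w) (r : Fin n → ℝ) (hr : ∀ j, 0 ≤ r j) :
    ∃ c, D.IsStoppingCertificate r c := by
  obtain ⟨hw, -⟩ := id h
  obtain ⟨g, hg0, hg⟩ := (mnlChain w hw).exists_value r hr
  set V : ℝ := ∑ k, w (some k) / (∑ i, w i) * g k with hV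
  -- All rows of `mnlChain` agree, so the value of continuing is `V` at every item.
  replace hg : ∀ j, g j = max (r j) V := hg
  have hW : 0 < ∑ i, w i := Finset.sum_pos (fun i _ => hw i) Finset.univ_nonempty
  have hV0 : 0 ≤ V := Finset.sum_nonneg fun k _ =>
    mul_nonneg (div_nonneg (hw _).le hW.le) (hg0 k)
  have hVW : V * (w none + ∑ i, w (some i)) = ∑ k, w (some k) * g k := by
    rw [← Fintype.sum_option, hV, Finset.sum_mul]
    refine Finset.sum_congr rfl fun k _ => ?_
    field_simp
  have hstep : ∀ u : List (Fin n), u.Nodup →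
      ∑ j with j ∉ u, D.prefixProb (u ++ [j]) * max (r j) V =
        D.prefixProb u * ((∑ j ∈ Finset.univ \ u.toFinset, w (some j) * g j) /
          (w none + ∑ i ∈ Finset.univ \ u.toFinset, w (some i))) := by
    intro u hu
    rw [← sum_notMem_eq (fun j => w (some j) * g j), Finset.sum_div, Finset.mul_sum]
    refine Finset.sum_congr rfl fun j hj => ?_
    have hj : j ∉ u := (Finset.mem_filter.1 hj).2
    rw [h.prefixProb_eq _ (nodup_append_singleton hu hj), h.prefixProb_eq _ hu,
      urnPrefixProb_append w _ u (Finset.mem_univ j) hj, hg]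
    ring
  -- Removing the items of `u` from the identity `hVW` leaves the correction `w (some j) * (g j -
  -- V)` on `u`: nonnegative in general, and zero when `r j < V` there.
  have hbal : ∀ u : List (Fin n), ∑ j ∈ Finset.univ \ u.toFinset, w (some j) * g j =
      V * (w none + ∑ i ∈ Finset.univ \ u.toFinset, w (some i)) -
        ∑ j ∈ u.toFinset, w (some j) * (g j - V) := by
    intro u
    have h1 := Finset.sum_sdiff (f := fun j => w (some j) * g j) (Finset.subset_univ u.toFinset)
    have h2 := Finset.sum_sdiff (f := fun j => w (some j)) (Finset.subset_univ u.toFinset)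
    rw [← hVW, ← h2] at h1
    simp only [mul_sub, Finset.sum_sub_distrib, ← Finset.sum_mul]
    linarith
  refine ⟨fun _ => V, fun _ => hV0, fun u hu => ?_, fun u hu hS => ?_⟩
  · rw [hstep u hu]
    refine mul_le_mul_of_nonneg_left ?_ (D.prefixProb_nonneg u)
    rw [div_le_iff₀ (urn_denominator_pos w hw _), hbal, sub_le_self_iff]
    refine Finset.sum_nonneg fun j _ => mul_nonneg (hw _).le (sub_nonneg.2 ?_)
    rw [hg]
    exact le_max_right _ _
  · rw [hstep u hu, hbal]
    have h0 : ∑ j ∈ u.toFinset, w (some j) * (g j - V) = 0 := by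
      refine Finset.sum_eq_zero fun j hj => ?_
      rw [hg, max_eq_right (hS j (List.mem_toFinset.1 hj)).le, sub_self, mul_zero]
    rw [h0, sub_zero, mul_div_cancel_right₀ _ (urn_denominator_pos w hw _).ne']

end ListDistribution

/-! ### Trajectories and their lists of first visits. -/

section Trajectory

variable {n : ℕ} {x y : ℕ → Option (Fin n)} {Ω : Type*} {X : ℕ → Ω → Option (Fin n)}

theorem firstVisits_congr {t : ℕ} (h : ∀ i < t, x i = y i) : firstVisits x t = firstVisits y t := by
  induction t with
  | zero => rfl
  | succ t ih =>
    simp only [firstVisits, ih fun i hi => h i (hi.trans t.lt_succ_self), h t t.lt_succ_self]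

theorem firstVisits_succ_of_mem {t : ℕ} {j : Fin n} (h : x t = some j)
    (hj : j ∈ firstVisits x t) : firstVisits x (t + 1) = firstVisits x t := by
  simp [firstVisits, h, hj]

theorem firstVisits_succ_of_notMem {t : ℕ} {j : Fin n} (h : x t = some j)
    (hj : j ∉ firstVisits x t) : firstVisits x (t + 1) = firstVisits x t ++ [j] := by
  simp [firstVisits, h, hj]

theorem firstVisits_prefix_succ (x : ℕ → Option (Fin n)) (t : ℕ) :
    firstVisits x t <+: firstVisits x (t + 1) := by
  rcases h : x t with _ | j
  · simp [firstVisits, h]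
  · by_cases hj : j ∈ firstVisits x t
    · rw [firstVisits_succ_of_mem h hj]
    · rw [firstVisits_succ_of_notMem h hj]
      exact List.prefix_append _ _

theorem firstVisits_prefix (x : ℕ → Option (Fin n)) {s t : ℕ} (h : s ≤ t) :
    firstVisits x s <+: firstVisits x t := by
  induction t, h using Nat.le_induction with
  | base => exact List.prefix_refl _
  | succ t _ ih => exact ih.trans (firstVisits_prefix_succ x t)

/-- The trajectory `x` has not terminated before time `t`, its items visited before time `t` are
those of `u`, in order of first visit, and it is in state `s` at time `t`. -/
def Reaches (x : ℕ → Option (Fin n)) (u : List (Fin n)) (t : ℕ) (s : Option (Fin n)) : Prop :=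
  (∀ i < t, x i ≠ none) ∧ firstVisits x t = u ∧ x t = s

theorem Reaches.congr {u : List (Fin n)} {t : ℕ} {s : Option (Fin n)} (hx : Reaches x u t s)
    (h : ∀ i ≤ t, x i = y i) : Reaches y u t s := by
  refine ⟨fun i hi => ?_, ?_, ?_⟩
  · rw [← h i hi.le]; exact hx.1 i hi
  · rw [← firstVisits_congr fun i hi => h i (le_of_lt hi)]; exact hx.2.1
  · rw [← h t le_rfl]; exact hx.2.2

theorem Reaches.firstVisits_succ {u : List (Fin n)} {t : ℕ} {j : Fin n}
    (hx : Reaches x u t (some j)) (hj : j ∉ u) : firstVisits x (t + 1) = u ++ [j] := by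
  obtain ⟨-, rfl, h⟩ := hx
  exact firstVisits_succ_of_notMem h hj

/-- `firstVisits x t` leaves out the state at time `t`. So that state is either an item already
listed, or it is `i` on its first visit. -/
theorem reaches_succ_iff {v : List (Fin n)} {i : Fin n} (hi : i ∉ v) {t : ℕ}
    {s : Option (Fin n)} :
    Reaches x (v ++ [i]) (t + 1) s ↔
      (∃ k ∈ v ++ [i], Reaches x (v ++ [i]) t (some k) ∧ x (t + 1) = s) ∨
        (Reaches x v t (some i) ∧ x (t + 1) = s) := by
  constructor
  · rintro ⟨h1, h2, h3⟩
    have h1' : ∀ m < t, x m ≠ none := fun m hm => h1 m (hm.trans t.lt_succ_self)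
    obtain ⟨k, hk⟩ := Option.ne_none_iff_exists'.1 (h1 t t.lt_succ_self)
    by_cases hkm : k ∈ firstVisits x t
    · rw [firstVisits_succ_of_mem hk hkm] at h2
      exact Or.inl ⟨k, h2 ▸ hkm, ⟨h1', h2, hk⟩, h3⟩
    · rw [firstVisits_succ_of_notMem hk hkm] at h2
      obtain ⟨h4, h5⟩ := List.append_inj' h2 rfl
      obtain rfl : k = i := by simpa using h5
      exact Or.inr ⟨⟨h1', h4, hk⟩, h3⟩
  · have aux : ∀ {u k}, Reaches x u t (some k) → ∀ m < t + 1, x m ≠ none := by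
      intro u k h m hm
      rcases Nat.lt_succ_iff_lt_or_eq.1 hm with hm | rfl
      · exact h.1 m hm
      · rw [h.2.2]; simp
    rintro (⟨k, hk, h, h3⟩ | ⟨h, h3⟩)
    · refine ⟨aux h, ?_, h3⟩
      rw [firstVisits_succ_of_mem h.2.2 (h.2.1.symm ▸ hk), h.2.1]
    · exact ⟨aux h, h.firstVisits_succ hi, h3⟩

/-- Right after the earlier time the list is `u ++ [j]`, which is too long to be a prefix of the
list `u` at the later time. -/
theorem Reaches.time_unique {u : List (Fin n)} {j : Fin n} (hj : j ∉ u) {t t' : ℕ}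
    (h : Reaches x u t (some j)) (h' : Reaches x u t' (some j)) : t = t' := by
  have key : ∀ {t t' : ℕ}, Reaches x u t (some j) → Reaches x u t' (some j) → ¬ t < t' := by
    intro t t' h h' hlt
    have hp := firstVisits_prefix x (Nat.succ_le_of_lt hlt)
    rw [Nat.succ_eq_add_one, h.firstVisits_succ hj, h'.2.1] at hp
    simpa using hp.length_le
  exact le_antisymm (not_lt.1 (key h' h)) (not_lt.1 (key h h'))

theorem exists_reaches_of_prefix {u : List (Fin n)} {j : Fin n} {T : ℕ}
    (hx : ∀ t < T, x t ≠ none) (h : u ++ [j] <+: firstVisits x T) :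
    ∃ t, Reaches x u t (some j) := by
  induction T with
  | zero => simp [firstVisits] at h
  | succ T ih =>
    have hx' : ∀ t < T, x t ≠ none := fun t ht => hx t (ht.trans T.lt_succ_self)
    obtain ⟨k, hk⟩ := Option.ne_none_iff_exists'.1 (hx T T.lt_succ_self)
    by_cases hkm : k ∈ firstVisits x T
    · rw [firstVisits_succ_of_mem hk hkm] at h
      exact ih hx' h
    · rw [firstVisits_succ_of_notMem hk hkm, List.prefix_concat_iff] at h
      rcases h with h | h
      · obtain ⟨h4, h5⟩ := List.append_inj' h rfl
        obtain rfl : j = k := by simpa using h5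
        exact ⟨T, hx', h4.symm, hk⟩
      · exact ih hx' h

/-- Turns prefix events of the list into events of the trajectory, to which the Markov property
applies. -/
theorem Generates.prefix_iff {u l : List (Fin n)} {j : Fin n} (hj : j ∉ u)
    (hl : Generates x l) : u ++ [j] <+: l ↔ ∃ t, Reaches x u t (some j) := by
  obtain ⟨T, hT, hx, rfl⟩ := hl
  refine ⟨exists_reaches_of_prefix hx, ?_⟩
  rintro ⟨t, ht⟩
  rw [← ht.firstVisits_succ hj]
  refine firstVisits_prefix x (Nat.succ_le_of_lt ?_)
  by_contra hlt
  rcases (not_lt.1 hlt).lt_or_eq with h | rfl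
  · exact ht.1 T h hT
  · rw [ht.2.2] at hT; cases hT

theorem Generates.unique {l l' : List (Fin n)} (h : Generates x l) (h' : Generates x l') :
    l = l' := by
  obtain ⟨T, hT, hx, rfl⟩ := h
  obtain ⟨T', hT', hx', rfl⟩ := h'
  have : T = T' := le_antisymm (not_lt.1 fun hlt => hx _ hlt hT') (not_lt.1 fun hlt => hx' _ hlt hT)
  rw [this]

/-- The trajectory that follows `p` and terminates thereafter. -/
def extendPath {t : ℕ} (p : Fin (t + 1) → Option (Fin n)) (i : ℕ) : Option (Fin n) :=
  if h : i < t + 1 then p ⟨i, h⟩ else none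

theorem not_reaches_nil_succ {t : ℕ} {s : Option (Fin n)} :
    ¬ Reaches x [] (t + 1) s := by
  rintro ⟨h1, h2, -⟩
  obtain ⟨k, hk⟩ := Option.ne_none_iff_exists'.1 (h1 0 t.succ_pos)
  have h3 := firstVisits_prefix x (Nat.succ_le_succ t.zero_le)
  rw [Nat.succ_eq_add_one, Nat.succ_eq_add_one, h2,
    firstVisits_succ_of_notMem hk (by simp [firstVisits])] at h3
  simpa using h3.length_le

/-- An event determined up to time `t` is a finite union of cylinders; the values of `extendPath`
after `t` play no role. -/
theorem setOf_eq_iUnion_cylinder {K : (ℕ → Option (Fin n)) → Prop} {t : ℕ}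
    (hK : ∀ x y : ℕ → Option (Fin n), (∀ i ≤ t, x i = y i) → K x → K y) :
    {ω | K (fun i => X i ω)} =
      ⋃ p : {p : Fin (t + 1) → Option (Fin n) // K (extendPath p)},
        {ω | ∀ s ≤ t, X s ω = extendPath p.1 s} := by
  ext ω
  simp only [Set.mem_ofPred_eq, Set.mem_iUnion, Subtype.exists, exists_prop]
  constructor
  · intro h
    have he : ∀ s ≤ t, X s ω = extendPath (fun i : Fin (t + 1) => X i ω) s := by
      intro s hs
      simp [extendPath, Nat.lt_succ_of_le hs]
    exact ⟨_, hK _ _ he h, he⟩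
  · rintro ⟨p, hp, h⟩
    exact hK _ _ (fun i hi => (h i hi).symm) hp

theorem disjoint_cylinder {t : ℕ} {p q : Fin (t + 1) → Option (Fin n)} (hpq : p ≠ q) :
    Disjoint {ω | ∀ s ≤ t, X s ω = extendPath p s} {ω | ∀ s ≤ t, X s ω = extendPath q s} := by
  rw [Set.disjoint_left]
  intro ω h h'
  apply hpq
  funext i
  have hi : (i : ℕ) ≤ t := Nat.lt_succ_iff.1 i.2
  have := (h i hi).symm.trans (h' i hi)
  simpa [extendPath, hi] using this

end Trajectory

/-! ### Measurability, the Markov property and limits in time. -/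

namespace ChainParams.IsTerminatingChain

variable {n : ℕ} {C : ChainParams n} {Ω : Type*} [MeasurableSpace Ω] {μ : Measure Ω}
  {X : ℕ → Ω → Option (Fin n)}

theorem measurableSet_cylinder (hX : C.IsTerminatingChain μ X) (t : ℕ)
    (x : ℕ → Option (Fin n)) : MeasurableSet {ω | ∀ s ≤ t, X s ω = x s} := by
  simp only [Set.ofPred_forall]
  exact MeasurableSet.iInter fun s => MeasurableSet.iInter fun _ => hX.measurable s (x s)

theorem measureReal_reaches_zero_of_ne_nil {u : List (Fin n)} (hu : u ≠ [])
    (s : Option (Fin n)) : μ.real {ω | Reaches (fun m => X m ω) u 0 s} = 0 := by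
  have : {ω | Reaches (fun m => X m ω) u 0 s} = ∅ := by
    ext ω
    simpa [Reaches, firstVisits] using fun h : u = [] => absurd h hu
  rw [this, measureReal_empty]

theorem measureReal_reaches_nil (hX : C.IsTerminatingChain μ X) (s : Option (Fin n)) :
    μ.real {ω | Reaches (fun m => X m ω) [] 0 s} = C.init s := by
  have h := hX.law 0 fun _ => s
  simpa [Reaches, firstVisits] using h

theorem measurableSet_of_past (hX : C.IsTerminatingChain μ X)
    {K : (ℕ → Option (Fin n)) → Prop} {t : ℕ}
    (hK : ∀ x y : ℕ → Option (Fin n), (∀ i ≤ t, x i = y i) → K x → K y) :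
    MeasurableSet {ω | K (fun i => X i ω)} := by
  rw [setOf_eq_iUnion_cylinder hK]
  exact MeasurableSet.iUnion fun p => hX.measurableSet_cylinder t _

theorem measurableSet_reaches (hX : C.IsTerminatingChain μ X) (u : List (Fin n)) (t : ℕ)
    (s : Option (Fin n)) : MeasurableSet {ω | Reaches (fun i => X i ω) u t s} :=
  hX.measurableSet_of_past (K := fun x => Reaches x u t s) (t := t)
    fun _ _ h hx => hx.congr h

theorem measurableSet_generates (hX : C.IsTerminatingChain μ X) (l : List (Fin n)) :
    MeasurableSet {ω | Generates (fun i => X i ω) l} := by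
  have : {ω | Generates (fun i => X i ω) l} = ⋃ T, {ω | Reaches (fun i => X i ω) l T none} := by
    ext ω
    simp only [Generates, Reaches, Set.mem_ofPred_eq, Set.mem_iUnion]
    exact exists_congr fun T => by tauto
  rw [this]
  exact MeasurableSet.iUnion fun T => hX.measurableSet_reaches l T none

variable [IsProbabilityMeasure μ]

/-- The Markov property: the state after time `t` depends on the past only through the state at
time `t`. -/
theorem measureReal_past_and_next (hX : C.IsTerminatingChain μ X)
    {K : (ℕ → Option (Fin n)) → Prop} {t : ℕ} {k : Option (Fin n)}
    (hK : ∀ x y : ℕ → Option (Fin n), (∀ i ≤ t, x i = y i) → K x → K y)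
    (hk : ∀ x, K x → x t = k) (s : Option (Fin n)) :
    μ.real {ω | K (fun i => X i ω) ∧ X (t + 1) ω = s} =
      μ.real {ω | K (fun i => X i ω)} * C.step k s := by
  classical
  have h1 : {ω | K (fun i => X i ω) ∧ X (t + 1) ω = s} =
      ⋃ p : {p : Fin (t + 1) → Option (Fin n) // K (extendPath p)},
        ({ω | ∀ i ≤ t, X i ω = extendPath p.1 i} ∩ {ω | X (t + 1) ω = s}) := by
    rw [← Set.iUnion_inter, ← setOf_eq_iUnion_cylinder hK]
    rfl
  rw [h1, setOf_eq_iUnion_cylinder hK, measureReal_iUnion_fintype, measureReal_iUnion_fintype,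
    Finset.sum_mul]
  · refine Finset.sum_congr rfl fun p _ => ?_
    -- Each piece is a cylinder one step longer, so `law` adds a single factor, which is `C.step k
    -- s` because `K` fixes the state at time `t`.
    have h2 : {ω | ∀ i ≤ t, X i ω = extendPath p.1 i} ∩ {ω | X (t + 1) ω = s} =
        {ω | ∀ i ≤ t + 1, X i ω = Function.update (extendPath p.1) (t + 1) s i} := by
      ext ω
      simp only [Set.mem_inter_iff, Set.mem_ofPred_eq]
      constructor
      · rintro ⟨h, h'⟩ i hi
        rcases hi.lt_or_eq with hi | rfl
        · rw [Function.update_of_ne hi.ne]; exact h i (Nat.lt_succ_iff.1 hi)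
        · rw [Function.update_self]; exact h'
      · intro h
        refine ⟨fun i hi => ?_, ?_⟩
        · have := h i (hi.trans t.le_succ)
          rwa [Function.update_of_ne (Nat.lt_succ_of_le hi).ne] at this
        · simpa using h (t + 1) le_rfl
    rw [h2, hX.law, hX.law, Finset.prod_range_succ, Function.update_self,
      Function.update_of_ne (by omega), Function.update_of_ne (by omega), hk _ p.2, ← mul_assoc]
    congr 2
    refine Finset.prod_congr rfl fun i hi => ?_
    rw [Finset.mem_range] at hi
    rw [Function.update_of_ne (by omega), Function.update_of_ne (by omega)]
  · exact fun p q hpq => disjoint_cylinder fun h => hpq (Subtype.ext h)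
  · exact fun p => hX.measurableSet_cylinder t _
  · exact fun p q hpq => (disjoint_cylinder fun h => hpq (Subtype.ext h)).mono
      Set.inter_subset_left Set.inter_subset_left
  · exact fun p => (hX.measurableSet_cylinder t _).inter (hX.measurable _ _)

theorem measureReal_reaches_succ (hX : C.IsTerminatingChain μ X) {v : List (Fin n)} {i : Fin n}
    (hi : i ∉ v) (t : ℕ) (s : Option (Fin n)) :
    μ.real {ω | Reaches (fun m => X m ω) (v ++ [i]) (t + 1) s} =
      ∑ k ∈ (v ++ [i]).toFinset,
        μ.real {ω | Reaches (fun m => X m ω) (v ++ [i]) t (some k)} * C.trans k s +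
      μ.real {ω | Reaches (fun m => X m ω) v t (some i)} * C.trans i s := by
  have h1 : {ω | Reaches (fun m => X m ω) (v ++ [i]) (t + 1) s} =
      (⋃ k ∈ (v ++ [i]).toFinset,
        {ω | Reaches (fun m => X m ω) (v ++ [i]) t (some k) ∧ X (t + 1) ω = s}) ∪
      {ω | Reaches (fun m => X m ω) v t (some i) ∧ X (t + 1) ω = s} := by
    ext ω
    simp only [Set.mem_ofPred_eq, reaches_succ_iff hi, Set.mem_union, Set.mem_iUnion,
      List.mem_toFinset, exists_prop]
  have hm : ∀ u k, MeasurableSet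
      {ω | Reaches (fun m => X m ω) u t (some k) ∧ X (t + 1) ω = s} := fun u k =>
    (hX.measurableSet_reaches u t (some k)).inter (hX.measurable _ _)
  have hnext : ∀ u k, μ.real {ω | Reaches (fun m => X m ω) u t (some k) ∧ X (t + 1) ω = s} =
      μ.real {ω | Reaches (fun m => X m ω) u t (some k)} * C.trans k s := fun u k =>
    hX.measureReal_past_and_next (K := fun x => Reaches x u t (some k)) (k := some k)
      (fun _ _ h hx => hx.congr h) (fun _ h => h.2.2) s
  rw [h1, measureReal_union _ (hm _ _) (measure_ne_top _ _),
    measureReal_biUnion_finset _ fun k _ => hm _ k, hnext]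
  · simp_rw [hnext]
  · intro k _ k' _ hkk'
    rw [Function.onFun, Set.disjoint_left]
    rintro ω ⟨h, -⟩ ⟨h', -⟩
    exact hkk' (Option.some_injective _ (h.2.2.symm.trans h'.2.2))
  · rw [Set.disjoint_left]
    rintro ω h ⟨h', -⟩
    simp only [Set.mem_iUnion] at h
    obtain ⟨k, _, h, -⟩ := h
    have := h.2.1.symm.trans h'.2.1
    simp at this

open Filter Topology in
-- The event lies in that of no termination before `t`; these decrease to a null set.
theorem tendsto_measureReal_reaches (hX : C.IsTerminatingChain μ X) (u : List (Fin n))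
    (k : Fin n) :
    Tendsto (fun t => μ.real {ω | Reaches (fun m => X m ω) u t (some k)}) atTop (𝓝 0) := by
  have hm : ∀ t, MeasurableSet {ω | ∀ i < t, X i ω ≠ none} := by
    intro t
    simp only [Set.ofPred_forall]
    exact MeasurableSet.iInter fun i => MeasurableSet.iInter fun _ => (hX.measurable i none).compl
  have h := tendsto_measure_iInter_atTop (μ := μ) (s := fun t => {ω | ∀ i < t, X i ω ≠ none})
    (fun t => (hm t).nullMeasurableSet)
    (fun s t hst ω hω i hi => hω i (hi.trans_le hst)) ⟨0, by finiteness⟩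
  have h0 : μ (⋂ t, {ω | ∀ i < t, X i ω ≠ none}) = 0 := by
    refine measure_mono_null ?_ (ae_iff.1 hX.terminates)
    intro ω hω
    rw [Set.mem_iInter] at hω
    rintro ⟨t, ht⟩
    exact hω (t + 1) t t.lt_succ_self ht
  rw [h0] at h
  have h' : Tendsto (fun t => μ.real {ω | ∀ i < t, X i ω ≠ none}) atTop (𝓝 0) := by
    exact (ENNReal.tendsto_toReal ENNReal.zero_ne_top).comp h
  refine squeeze_zero (fun _ => measureReal_nonneg) (fun t => ?_) h'
  exact measureReal_mono fun ω hω => hω.1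

open Filter Topology in
theorem tendsto_sum_measureReal_reaches (hX : C.IsTerminatingChain μ X) {u : List (Fin n)}
    {j : Fin n} (hj : j ∉ u) :
    Tendsto (fun T => ∑ t ∈ Finset.range T, μ.real {ω | Reaches (fun m => X m ω) u t (some j)})
      atTop (𝓝 (μ.real {ω | ∃ t, Reaches (fun m => X m ω) u t (some j)})) := by
  have hm := fun t => hX.measurableSet_reaches u t (some j)
  have hd : Pairwise (Function.onFun Disjoint
      fun t => {ω | Reaches (fun m => X m ω) u t (some j)}) := by
    intro t t' htt'
    rw [Function.onFun, Set.disjoint_left]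
    exact fun ω h h' => htt' (Reaches.time_unique hj h h')
  have h := measure_iUnion (μ := μ) hd hm
  have hs := ENNReal.hasSum_toReal (h ▸ measure_ne_top μ _)
  rw [← ENNReal.tsum_toReal_eq fun t => measure_ne_top μ _, ← h] at hs
  rw [Set.ofPred_exists]
  exact hs.tendsto_sum_nat

end ChainParams.IsTerminatingChain

/-! ### Prefix probabilities through the chain. -/

namespace ListDistribution

variable {n : ℕ} {D : ListDistribution n} {C : ChainParams n} {Ω : Type*} [MeasurableSpace Ω]
  {μ : Measure Ω} [IsProbabilityMeasure μ] {X : ℕ → Ω → Option (Fin n)}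

theorem IsLawOfGeneratedList.measureReal_exists_generates (hD : D.IsLawOfGeneratedList μ X)
    (hX : C.IsTerminatingChain μ X) {A : Finset (List (Fin n))} (hA : A ⊆ D.support) :
    μ.real {ω | ∃ l ∈ A, Generates (fun t => X t ω) l} = ∑ l ∈ A, D.prob l := by
  have h : {ω | ∃ l ∈ A, Generates (fun t => X t ω) l} =
      ⋃ l ∈ A, {ω | Generates (fun t => X t ω) l} := by
    ext ω; simp
  rw [h, measureReal_biUnion_finset _ fun l _ => hX.measurableSet_generates l]
  · exact Finset.sum_congr rfl fun l hl => (hD l (hA hl)).symm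
  · intro l _ l' _ hll'
    rw [Function.onFun, Set.disjoint_left]
    exact fun ω h h' => hll' (h.unique h')

/-- The law is prescribed only on `D.support`, but the probabilities there already sum to 1, so
other lists are negligible. -/
theorem IsLawOfGeneratedList.ae_exists_generates (hD : D.IsLawOfGeneratedList μ X)
    (hX : C.IsTerminatingChain μ X) :
    ∀ᵐ ω ∂μ, ∃ l ∈ D.support, Generates (fun t => X t ω) l := by
  have h := hD.measureReal_exists_generates hX (Finset.Subset.refl _)
  rw [D.sum_prob] at h
  have hm : MeasurableSet {ω | ∃ l ∈ D.support, Generates (fun t => X t ω) l} := by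
    have h : {ω | ∃ l ∈ D.support, Generates (fun t => X t ω) l} =
        ⋃ l ∈ D.support, {ω | Generates (fun t => X t ω) l} := by
      ext ω; simp
    rw [h]
    exact Finset.measurableSet_biUnion _ fun l _ => hX.measurableSet_generates l
  have h1 : μ {ω | ∃ l ∈ D.support, Generates (fun t => X t ω) l} = 1 := by
    rwa [measureReal_def, ENNReal.toReal_eq_one_iff] at h
  exact (prob_compl_eq_zero_iff hm).2 h1

theorem IsLawOfGeneratedList.prefixProb_append (hD : D.IsLawOfGeneratedList μ X)
    (hX : C.IsTerminatingChain μ X) {u : List (Fin n)} {j : Fin n} (hj : j ∉ u) :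
    D.prefixProb (u ++ [j]) = μ.real {ω | ∃ t, Reaches (fun m => X m ω) u t (some j)} := by
  rw [prefixProb, ← hD.measureReal_exists_generates hX (Finset.filter_subset _ _)]
  refine measureReal_congr ?_
  filter_upwards [hD.ae_exists_generates hX] with ω hω
  obtain ⟨l, hl, hg⟩ := hω
  refine propext ⟨?_, ?_⟩
  · rintro ⟨l', hl', hg'⟩
    exact (hg'.prefix_iff hj).1 (Finset.mem_filter.1 hl').2
  · intro h
    exact ⟨l, Finset.mem_filter.2 ⟨hl, (hg.prefix_iff hj).2 h⟩, hg⟩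

open Filter Topology in
theorem IsLawOfGeneratedList.tendsto_sum_reaches (hD : D.IsLawOfGeneratedList μ X)
    (hX : C.IsTerminatingChain μ X) {u : List (Fin n)} {j : Fin n} (hj : j ∉ u) :
    Tendsto (fun T => ∑ t ∈ Finset.range T, μ.real {ω | Reaches (fun m => X m ω) u t (some j)})
      atTop (𝓝 (D.prefixProb (u ++ [j]))) := by
  rw [hD.prefixProb_append hX hj]
  exact hX.tendsto_sum_measureReal_reaches hj

theorem IsLawOfGeneratedList.prefixProb_singleton (hD : D.IsLawOfGeneratedList μ X)
    (hX : C.IsTerminatingChain μ X) (j : Fin n) : D.prefixProb [j] = C.init (some j) := by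
  have h := hD.prefixProb_append hX (u := []) (j := j) (by simp)
  rw [List.nil_append] at h
  rw [h, ← hX.measureReal_reaches_nil]
  congr 1
  ext ω
  refine ⟨?_, fun h => ⟨0, h⟩⟩
  rintro ⟨_ | t, h⟩
  · exact h
  · exact absurd h not_reaches_nil_succ

end ListDistribution

/-! ### The certificate for Markov chains. -/

section Chain

variable {n : ℕ} {C : ChainParams n} {Ω : Type*} [MeasurableSpace Ω]
  {μ : Measure Ω} [IsProbabilityMeasure μ] {X : ℕ → Ω → Option (Fin n)}

/-- Balance of the expected value of `g` while the list of visited items is `v ++ [i]`: what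
leaves, what is still there at time `T`, and what is lost add up to what has entered. -/
theorem ChainParams.IsTerminatingChain.sum_reaches_balance (hX : C.IsTerminatingChain μ X)
    {v : List (Fin n)} {i : Fin n} (hi : i ∉ v) (g : Fin n → ℝ) (T : ℕ) :
    ∑ k with k ∉ v ++ [i], (∑ t ∈ Finset.range (T + 1),
        μ.real {ω | Reaches (fun m => X m ω) (v ++ [i]) t (some k)}) * g k +
      ∑ k ∈ (v ++ [i]).toFinset,
        μ.real {ω | Reaches (fun m => X m ω) (v ++ [i]) T (some k)} * g k +
      ∑ t ∈ Finset.range T, ∑ k ∈ (v ++ [i]).toFinset,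
        μ.real {ω | Reaches (fun m => X m ω) (v ++ [i]) t (some k)} *
          (g k - ∑ m, C.trans k (some m) * g m) =
      (∑ t ∈ Finset.range T, μ.real {ω | Reaches (fun m => X m ω) v t (some i)}) *
        ∑ m, C.trans i (some m) * g m := by
  have hrec := fun t m => hX.measureReal_reaches_succ hi t (some m)
  have hzero := fun m : Fin n => ChainParams.IsTerminatingChain.measureReal_reaches_zero_of_ne_nil
    (μ := μ) (X := X) (u := v ++ [i]) (by simp) (some m)
  set A : ℕ → Fin n → ℝ :=
    fun t k => μ.real {ω | Reaches (fun m => X m ω) (v ++ [i]) t (some k)} with hA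
  set B : ℕ → ℝ := fun t => μ.real {ω | Reaches (fun m => X m ω) v t (some i)} with hB
  change ∀ t m, A (t + 1) m = ∑ k ∈ (v ++ [i]).toFinset, A t k * C.trans k (some m) +
    B t * C.trans i (some m) at hrec
  change ∀ m, A 0 m = 0 at hzero
  change ∑ k with k ∉ v ++ [i], (∑ t ∈ Finset.range (T + 1), A t k) * g k +
      ∑ k ∈ (v ++ [i]).toFinset, A T k * g k +
      ∑ t ∈ Finset.range T, ∑ k ∈ (v ++ [i]).toFinset,
        A t k * (g k - ∑ m, C.trans k (some m) * g m) =
      (∑ t ∈ Finset.range T, B t) * ∑ m, C.trans i (some m) * g m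
  induction T with
  | zero => simp [hzero]
  | succ T ih =>
    have h1 : ∑ k with k ∉ v ++ [i], A (T + 1) k * g k +
        ∑ k ∈ (v ++ [i]).toFinset, A (T + 1) k * g k = ∑ k, A (T + 1) k * g k := by
      rw [sum_notMem_eq (fun k => A (T + 1) k * g k)]
      exact Finset.sum_sdiff (Finset.subset_univ _)
    have h2 : ∑ k, A (T + 1) k * g k =
        ∑ k ∈ (v ++ [i]).toFinset, A T k * ∑ m, C.trans k (some m) * g m +
          -- One step of the chain: the mass at time `T + 1` comes from listed items at time `T` or
          -- from a first visit to `i` at time `T`.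
          B T * ∑ m, C.trans i (some m) * g m := by
      simp_rw [hrec, add_mul, Finset.sum_add_distrib, Finset.sum_mul, Finset.mul_sum, mul_assoc]
      rw [Finset.sum_comm]
    have h3 : ∑ k with k ∉ v ++ [i], (∑ t ∈ Finset.range (T + 1 + 1), A t k) * g k =
        ∑ k with k ∉ v ++ [i], (∑ t ∈ Finset.range (T + 1), A t k) * g k +
          ∑ k with k ∉ v ++ [i], A (T + 1) k * g k := by
      rw [← Finset.sum_add_distrib]
      refine Finset.sum_congr rfl fun k _ => ?_
      rw [Finset.sum_range_succ, add_mul]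
    have h4 : ∑ k ∈ (v ++ [i]).toFinset, A T k * (g k - ∑ m, C.trans k (some m) * g m) =
        ∑ k ∈ (v ++ [i]).toFinset, A T k * g k -
          ∑ k ∈ (v ++ [i]).toFinset, A T k * ∑ m, C.trans k (some m) * g m := by
      simp_rw [mul_sub, Finset.sum_sub_distrib]
    rw [h3, Finset.sum_range_succ _ T, Finset.sum_range_succ B T, h4, add_mul]
    linarith

variable {D : ListDistribution n}

open Filter Topology in
theorem ListDistribution.IsLawOfGeneratedList.exists_certificate
    (hD : D.IsLawOfGeneratedList μ X) (hX : C.IsTerminatingChain μ X) (r : Fin n → ℝ)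
    (hr : ∀ j, 0 ≤ r j) : ∃ c, D.IsStoppingCertificate r c := by
  obtain ⟨g, hg0, hg⟩ := C.exists_value r hr
  have hc0 : ∀ j, 0 ≤ ∑ k, C.trans j (some k) * g k := fun j =>
    Finset.sum_nonneg fun k _ => mul_nonneg (C.trans_nonneg _ _) (hg0 k)
  have hinit : ∑ j with j ∉ ([] : List (Fin n)), D.prefixProb ([] ++ [j]) * g j =
      D.prefixProb [] * ∑ k, C.init (some k) * g k := by
    simp [D.prefixProb_nil, hD.prefixProb_singleton hX]
  -- As `T` grows, the expected visits outside `u` tend to prefix probabilities, and the mass still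
  -- wandering inside `u` vanishes by termination.
  have hleft : ∀ u : List (Fin n), Tendsto (fun T =>
      ∑ k with k ∉ u, (∑ t ∈ Finset.range (T + 1),
        μ.real {ω | Reaches (fun m => X m ω) u t (some k)}) * g k +
      ∑ k ∈ u.toFinset, μ.real {ω | Reaches (fun m => X m ω) u T (some k)} * g k)
      atTop (𝓝 (∑ j with j ∉ u, D.prefixProb (u ++ [j]) * g j)) := by
    intro u
    have h1 : Tendsto (fun T => ∑ k with k ∉ u, (∑ t ∈ Finset.range (T + 1),
        μ.real {ω | Reaches (fun m => X m ω) u t (some k)}) * g k) atTop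
        (𝓝 (∑ j with j ∉ u, D.prefixProb (u ++ [j]) * g j)) :=
      tendsto_finsetSum _ fun k hk =>
        ((hD.tendsto_sum_reaches hX (Finset.mem_filter.1 hk).2).comp
          (tendsto_add_atTop_nat 1)).mul_const _
    have h2 : Tendsto (fun T => ∑ k ∈ u.toFinset,
        μ.real {ω | Reaches (fun m => X m ω) u T (some k)} * g k) atTop
        (𝓝 (∑ k ∈ u.toFinset, 0 * g k)) :=
      tendsto_finsetSum _ fun k _ => (hX.tendsto_measureReal_reaches u k).mul_const _
    simpa using h1.add h2
  have hright : ∀ (v : List (Fin n)) (i : Fin n), i ∉ v → Tendsto (fun T =>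
      (∑ t ∈ Finset.range T, μ.real {ω | Reaches (fun m => X m ω) v t (some i)}) *
        ∑ m, C.trans i (some m) * g m) atTop
      (𝓝 (D.prefixProb (v ++ [i]) * ∑ m, C.trans i (some m) * g m)) := fun v i hi =>
    (hD.tendsto_sum_reaches hX hi).mul_const _
  have hnotMem : ∀ {v : List (Fin n)} {i : Fin n}, (v ++ [i]).Nodup → i ∉ v :=
    fun h hi => (List.nodup_append.1 h).2.2 _ hi _ (by simp) rfl
  -- With this `c`, `max (r j) (c (some j))` is `g j`.
  refine ⟨fun s => s.elim (∑ k, C.init (some k) * g k) fun j => ∑ k, C.trans j (some k) * g k,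
    ?_, fun u hu => ?_, fun u hu hS => ?_⟩
  · rintro (_ | j)
    · exact Finset.sum_nonneg fun k _ => mul_nonneg (C.init_nonneg _) (hg0 k)
    · exact hc0 j
  · simp only [Option.elim_some, ← hg]
    rcases List.eq_nil_or_concat u with rfl | ⟨v, i, rfl⟩
    · exact hinit.le
    · rw [List.concat_eq_append] at hu ⊢
      rw [List.getLast?_append_of_ne_nil _ (by simp), List.getLast?_singleton, Option.elim_some]
      refine le_of_tendsto_of_tendsto' (hleft _) (hright v i (hnotMem hu)) fun T => ?_
      -- The gap is the accumulated loss `g k - ∑ m, C.trans k (some m) * g m` over time spent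
      -- inside `u`, which is nonnegative.
      rw [← hX.sum_reaches_balance (hnotMem hu) g T]
      refine le_add_of_nonneg_right (Finset.sum_nonneg fun t _ => Finset.sum_nonneg fun k _ =>
        mul_nonneg measureReal_nonneg (sub_nonneg.2 ?_))
      rw [hg k]
      exact le_max_right _ _
  · simp only [Option.elim_some, ← hg] at hS ⊢
    rcases List.eq_nil_or_concat u with rfl | ⟨v, i, rfl⟩
    · exact hinit
    · rw [List.concat_eq_append] at hu hS ⊢
      rw [List.getLast?_append_of_ne_nil _ (by simp), List.getLast?_singleton, Option.elim_some]
      refine tendsto_nhds_unique (hleft _) ((hright v i (hnotMem hu)).congr fun T => ?_)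
      -- Here no loss accrues, since `r k < c (some k)` forces `g k = c (some k)` throughout `u`.
      rw [← hX.sum_reaches_balance (hnotMem hu) g T, add_eq_left]
      refine Finset.sum_eq_zero fun t _ => Finset.sum_eq_zero fun k hk => ?_
      rw [hg k, max_eq_right (hS k (List.mem_toFinset.1 hk)).le, sub_self, mul_zero]

end Chain

end FixedPrice

end

theorem theorem1 (n : ℕ) (r : Fin n → ℝ) (hr : ∀ j, 0 ≤ r j)
    (D : FixedPrice.ListDistribution n) :
    (∀ (C : FixedPrice.ChainParams n) (Ω : Type*) [MeasurableSpace Ω]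
        (μ : MeasureTheory.Measure Ω) [MeasureTheory.IsProbabilityMeasure μ]
        (X : ℕ → Ω → Option (Fin n)),
        C.IsTerminatingChain μ X → D.IsLawOfGeneratedList μ X → D.AssortmentsOptimal r) ∧
    (∀ w : Option (Fin n) → ℝ, D.IsMNL w → D.AssortmentsOptimal r) := by
  refine ⟨fun C Ω _ μ _ X hX hD => ?_, fun w hw => ?_⟩
  · obtain ⟨c, hc⟩ := hD.exists_certificate hX r hr
    exact hc.assortmentsOptimal
  · obtain ⟨c, hc⟩ := hw.exists_certificate r hr
    exact hc.assortmentsOptimal
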